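/- Call two distinct letters $x,y$ alternating in a word $w$ if deleting from $w$ all letters other than the copies of $x$ and $y$ leaves a word of the form $xyxy\cdots$ or $yxyx\cdots$ (of even or odd length). A graph $G=(V,E)$ is word-representable if there is a finite word $w$ over the alphabet $V$, containing each letter of $V$, such that for all $x\neq y$ in $V$ the letters $x$ and $y$ alternate in $w$ if and only if $xy\in E$. For $i=1,2,3,4$ let $T_i$ be the graph consisting of a clique $\{a,b,c,d\}$ on four vertices and further, pairwise non-adjacent vertices whose neighbourhoods are: $T_1$: $\{a,b\},\{a,c\},\{b,c\}$ (7 vertices); $T_2$: $\{a,b\},\{a,c\},\{a,d\}$ (7 vertices); $T_3$: $\{a,b,c\},\{a,b,d\},\{a,c,d\}$ (7 vertices); $T_4$: $\{a,b\},\{a,d\},\{a,b,c\},\{a,c,d\}$ (8 vertices). **Theorem.** Let $S_n=(E_{n-4},K_4)$ be a split graph, that is, a finite simple graph on $n$ vertices whose vertex set is partitioned into an independent set $E_{n-4}$ and a clique $K_4$ of size $4$ which is a maximal clique (equivalently, every vertex of $E_{n-4}$ has degree at most $3$). Then $S_n$ is word-representable if and only if it contains none of $T_1,T_2,T_3,T_4$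 as an induced subgraph. -/

import Mathlib

/-- The word `a b a b ⋯` of length `n`, starting with `a`. -/
def altWord {V : Type*} (a b : V) : ℕ → List V
  | 0 => []
  | n + 1 => a :: altWord b a n

open Classical in
/-- The letters `x` and `y` alternate in the word `w`: deleting from `w` all letters other than the
copies of `x` and `y` leaves a word `xyxy⋯` or a word `yxyx⋯`, of even or odd length. -/
def LettersAlternate {V : Type*} (w : List V) (x y : V) : Prop :=
  ∃ n : ℕ, w.filter (fun a => a = x ∨ a = y) = altWord x y n ∨
    w.filter (fun a => a = x ∨ a = y) = altWord y x n

/-- The word `w` represents the graph `G`: it contains each vertex as a letter, and two distinct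
letters alternate in `w` exactly when they are adjacent in `G`. -/
def WordRepresents {V : Type*} (w : List V) (G : SimpleGraph V) : Prop :=
  (∀ v : V, v ∈ w) ∧ ∀ x y : V, x ≠ y → (LettersAlternate w x y ↔ G.Adj x y)

/-- A graph is word-representable if some word over its vertex set represents it. -/
def WordRepresentable {V : Type*} (G : SimpleGraph V) : Prop :=
  ∃ w : List V, WordRepresents w G

/-- `G` is the split graph `(E, K)`: its vertex set is partitioned into an independent set `E`
and a clique `K` which is maximal, i.e. no vertex of `E` is adjacent to all vertices of `K`. -/
structure IsSplitPartition {V : Type*} (G : SimpleGraph V) (E K : Set V) : Prop where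
  isCompl : IsCompl E K
  isIndepSet : G.IsIndepSet E
  isMaximalClique : Maximal G.IsClique K

/-- The graph `T₁`: a clique `{0, 1, 2, 3}` and vertices `4`, `5`, `6` with neighbourhoods
`{0, 1}`, `{0, 2}`, `{1, 2}`. -/
def splitT1 : SimpleGraph (Fin 7) :=
  SimpleGraph.fromEdgeSet
    {s(0, 1), s(0, 2), s(0, 3), s(1, 2), s(1, 3), s(2, 3),
     s(4, 0), s(4, 1), s(5, 0), s(5, 2), s(6, 1), s(6, 2)}

/-- The graph `T₂`: a clique `{0, 1, 2, 3}` and vertices `4`, `5`, `6` with neighbourhoods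
`{0, 1}`, `{0, 2}`, `{0, 3}`. -/
def splitT2 : SimpleGraph (Fin 7) :=
  SimpleGraph.fromEdgeSet
    {s(0, 1), s(0, 2), s(0, 3), s(1, 2), s(1, 3), s(2, 3),
     s(4, 0), s(4, 1), s(5, 0), s(5, 2), s(6, 0), s(6, 3)}

/-- The graph `T₃`: a clique `{0, 1, 2, 3}` and vertices `4`, `5`, `6` with neighbourhoods
`{0, 1, 2}`, `{0, 1, 3}`, `{0, 2, 3}`. -/
def splitT3 : SimpleGraph (Fin 7) :=
  SimpleGraph.fromEdgeSet
    {s(0, 1), s(0, 2), s(0, 3), s(1, 2), s(1, 3), s(2, 3),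
     s(4, 0), s(4, 1), s(4, 2), s(5, 0), s(5, 1), s(5, 3), s(6, 0), s(6, 2), s(6, 3)}

/-- The graph `T₄`: a clique `{0, 1, 2, 3}` and vertices `4`, `5`, `6`, `7` with neighbourhoods
`{0, 1}`, `{0, 3}`, `{0, 1, 2}`, `{0, 2, 3}`. -/
def splitT4 : SimpleGraph (Fin 8) :=
  SimpleGraph.fromEdgeSet
    {s(0, 1), s(0, 2), s(0, 3), s(1, 2), s(1, 3), s(2, 3),
     s(4, 0), s(4, 1), s(5, 0), s(5, 3),
     s(6, 0), s(6, 1), s(6, 2), s(7, 0), s(7, 2), s(7, 3)}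

/-!
A graph represented by a word is partially ordered by comparing, in every prefix of the word, the
numbers of copies of two letters. Adjacent vertices are comparable, since alternating letters have
counts that differ by at most one and always in the same direction; and if `x ≤ x' ≤ y' ≤ y` with `x`
and `y` adjacent, the counts of `x'` and `y'` are squeezed between those of `x` and `y`, so `x'` and `y'`
are adjacent or equal (`WordRepresents.isSemiTransitiveOrder`). A 4-clique is a chain
`k 0 < k 1 < k 2 < k 3` in this order. Regard it as a 4-cycle: no vertex has exactly two opposite
neighbours on it (`IsSemiTransitiveOrder.not_adj_zero_two`), and no two non-adjacent vertices miss
exactly one vertex each, these being opposite (`IsSemiTransitiveOrder.adj_of_miss_zero_two`). In each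
of the four graphs every ordering of the clique violates one of these conditions, and the order passes
to induced subgraphs.

Conversely, suppose that none of the four graphs is an induced subgraph. Consider the pairs and the
complements of single vertices that occur as neighbourhoods in the clique. The absence of the four
graphs makes it possible to arrange the clique as `a, b, c, d` such that neither `{a, c}` nor `{b, d}` is
a neighbourhood and no vertex misses only `b` or only `c` (`exists_arrangement`). One of the cases uses
`splitT1` with another clique, in which a vertex of the independent set takes part
(`splitT1_isIndContained_of_centre`). Every neighbourhood is then `{a, d}` or an interval of the arranged
clique, and the explicit word `splitWord` represents the graph. Non-adjacency is witnessed there by a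
factor with two copies of one letter and none of the other; for two independent vertices of the same
kind such a factor comes from writing a list of vertices and later its reverse.
-/

/-! ### Alternating letters and prefix counts -/

open Classical in
/-- In every prefix of `w` the letter `x` occurs as often as `y`, or once more. For `x ≠ y` this
says that deleting the other letters from `w` leaves `xyxy⋯`. -/
def Leads {V : Type*} (w : List V) (x y : V) : Prop :=
  ∀ p, p <+: w → p.count y ≤ p.count x ∧ p.count x ≤ p.count y + 1

open Classical in
lemma leads_cons {V : Type*} {w : List V} {x y c : V} :
    Leads (c :: w) x y ↔ ∀ p, p <+: w →
      (c :: p).count y ≤ (c :: p).count x ∧ (c :: p).count x ≤ (c :: p).count y + 1 := by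
  constructor
  · intro h p hp
    exact h _ (by simpa using hp)
  · intro h p hp
    rcases List.prefix_cons_iff.1 hp with rfl | ⟨t, rfl, ht⟩
    · simp
    · exact h t ht

open Classical in
lemma exists_filter_eq_altWord_iff {V : Type*} (w : List V) {x y : V} (hxy : x ≠ y) :
    (∃ n, w.filter (fun a => a = x ∨ a = y) = altWord x y n) ↔ Leads w x y := by
  induction w generalizing x y with
  | nil =>
    refine iff_of_true ⟨0, by simp [altWord]⟩ ?_
    intro p hp
    simp [List.prefix_nil.1 hp]
  | cons c w ih =>
    rw [leads_cons]
    by_cases hcx : c = x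
    · subst hcx
      have ih' := ih hxy.symm
      have hcomm : (fun a : V => decide (a = y ∨ a = c)) = fun a => decide (a = c ∨ a = y) := by
        funext a; simp [or_comm]
      rw [hcomm] at ih'
      have h1 : (∃ n, (c :: w).filter (fun a => a = c ∨ a = y) = altWord c y n) ↔
          ∃ n, w.filter (fun a => a = c ∨ a = y) = altWord y c n := by
        constructor
        · rintro ⟨n, hn⟩
          cases n with
          | zero => simp [altWord] at hn
          | succ n => exact ⟨n, by simpa [altWord] using hn⟩
        · rintro ⟨n, hn⟩
          exact ⟨n + 1, by simpa [altWord] using hn⟩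
      rw [h1, ih']
      refine forall₂_congr fun p _ => ?_
      rw [List.count_cons_self, List.count_cons_of_ne hxy]
      omega
    · by_cases hcy : c = y
      · subst hcy
        refine iff_of_false ?_ ?_
        · rintro ⟨n, hn⟩
          cases n with
          | zero => simp [altWord] at hn
          | succ n => simp [altWord, hcx] at hn
        · intro h
          have := (h [] (by simp)).1
          simp [hcx] at this
      · have : (c :: w).filter (fun a => a = x ∨ a = y) = w.filter (fun a => a = x ∨ a = y) := by
          simp [hcx, hcy]
        rw [this, ih hxy]
        refine forall₂_congr fun p _ => ?_
        rw [List.count_cons_of_ne hcx, List.count_cons_of_ne hcy]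

lemma lettersAlternate_comm {V : Type*} {w : List V} {x y : V} :
    LettersAlternate w x y ↔ LettersAlternate w y x := by
  have : ∀ x y, LettersAlternate w x y → LettersAlternate w y x := by
    classical
    rintro x y ⟨n, h⟩
    have hcomm : (fun a : V => decide (a = y ∨ a = x)) = fun a => decide (a = x ∨ a = y) := by
      funext a; simp [or_comm]
    exact ⟨n, by rw [hcomm]; exact h.symm⟩
  exact ⟨this _ _, this _ _⟩

lemma lettersAlternate_iff {V : Type*} {w : List V} {x y : V} (hxy : x ≠ y) :
    LettersAlternate w x y ↔ Leads w x y ∨ Leads w y x := by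
  classical
  have hcomm : (fun a : V => decide (a = y ∨ a = x)) = fun a => decide (a = x ∨ a = y) := by
    funext a; simp [or_comm]
  rw [LettersAlternate, exists_or, exists_filter_eq_altWord_iff w hxy,
    ← exists_filter_eq_altWord_iff w hxy.symm, hcomm]

open Classical in
/-- Letters that alternate in a word have almost equal multiplicities in each of its factors. -/
lemma LettersAlternate.count_le_of_isInfix {V : Type*} {w q : List V} {x y : V}
    (h : LettersAlternate w x y) (hxy : x ≠ y) (hq : q <:+: w) :
    q.count x ≤ q.count y + 1 := by
  obtain ⟨p, r, rfl⟩ := hq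
  have h1 : p <+: p ++ q ++ r := ⟨q ++ r, by simp⟩
  have h2 : p ++ q <+: p ++ q ++ r := ⟨r, rfl⟩
  rcases (lettersAlternate_iff hxy).1 h with h | h
  · have := h _ h1; have := h _ h2
    simp only [List.count_append] at *
    omega
  · have := h _ h1; have := h _ h2
    simp only [List.count_append] at *
    omega

/-! ### The order of a word-representable graph -/

/-- The order-theoretic form of a semi-transitive orientation: a partial order in which adjacent
vertices are comparable, and any two distinct comparable vertices of an interval with adjacent end
points are adjacent. -/
structure IsSemiTransitiveOrder {V : Type*} (G : SimpleGraph V) (le : V → V → Prop) : Prop where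
  refl : ∀ x, le x x
  trans : ∀ {x y z}, le x y → le y z → le x z
  antisymm : ∀ {x y}, le x y → le y x → x = y
  total_of_adj : ∀ {x y}, G.Adj x y → le x y ∨ le y x
  adj_of_le : ∀ {x x' y' y}, le x x' → le x' y' → le y' y → x' ≠ y' → G.Adj x y → G.Adj x' y'

open Classical in
/-- Ordering the vertices by their numbers of copies in all prefixes: adjacent vertices are alternating
letters, whose counts differ by at most one, and this bound passes to all pairs in between. -/
lemma WordRepresents.isSemiTransitiveOrder {V : Type*} {w : List V} {G : SimpleGraph V}
    (h : WordRepresents w G) :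
    IsSemiTransitiveOrder G fun x y => ∀ p, p <+: w → p.count y ≤ p.count x := by
  obtain ⟨hmem, hadj⟩ := h
  have hanti : ∀ {x y : V}, (∀ p, p <+: w → p.count y ≤ p.count x) →
      (∀ p, p <+: w → p.count x ≤ p.count y) → x = y := by
    intro x y hxy hyx
    by_contra hne
    -- `s` has no `x`, hence no `y`; so `s ++ [x]` has more copies of `x` than of `y`
    obtain ⟨s, t, hw, hs⟩ := List.eq_append_cons_of_mem (hmem x)
    have h1 := hxy s ⟨x :: t, hw.symm⟩
    have h2 := hyx (s ++ [x]) ⟨t, by simp [hw]⟩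
    simp only [List.count_append, List.count_singleton_self, List.count_eq_zero_of_not_mem hs,
      List.count_singleton, beq_iff_eq, if_neg hne] at h1 h2
    omega
  refine ⟨fun x p _ => le_rfl, fun h1 h2 p hp => (h2 p hp).trans (h1 p hp), hanti, ?_, ?_⟩
  · intro x y hxy
    rcases (lettersAlternate_iff hxy.ne).1 ((hadj x y hxy.ne).2 hxy) with h | h
    · exact Or.inl fun p hp => (h p hp).1
    · exact Or.inr fun p hp => (h p hp).1
  · intro x x' y' y h1 h2 h3 hne hxy
    rw [← hadj _ _ hne, lettersAlternate_iff hne]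
    refine Or.inl fun p hp => ⟨h2 p hp, ?_⟩
    have hle : p.count x ≤ p.count y + 1 := by
      rcases (lettersAlternate_iff hxy.ne).1 ((hadj x y hxy.ne).2 hxy) with h | h
      · exact (h p hp).2
      · exact absurd (hanti (fun p hp => (h3 p hp).trans ((h2 p hp).trans (h1 p hp)))
          fun p hp => (h p hp).1) hxy.ne
    have := h1 p hp
    have := h3 p hp
    omega

namespace IsSemiTransitiveOrder

variable {V W : Type*} {G : SimpleGraph V} {H : SimpleGraph W} {le : V → V → Prop}

lemma flip (h : IsSemiTransitiveOrder G le) : IsSemiTransitiveOrder G fun x y => le y x where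
  refl := h.refl
  trans h1 h2 := h.trans h2 h1
  antisymm h1 h2 := h.antisymm h2 h1
  total_of_adj hxy := (h.total_of_adj hxy).symm
  adj_of_le h1 h2 h3 hne hxy := (h.adj_of_le h3 h2 h1 hne.symm hxy.symm).symm

lemma comap (h : IsSemiTransitiveOrder G le) (f : H ↪g G) :
    IsSemiTransitiveOrder H fun x y => le (f x) (f y) where
  refl _ := h.refl _
  trans h1 h2 := h.trans h1 h2
  antisymm h1 h2 := f.injective (h.antisymm h1 h2)
  total_of_adj hxy := h.total_of_adj (f.map_adj_iff.2 hxy)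
  adj_of_le h1 h2 h3 hne hxy :=
    f.map_adj_iff.1 (h.adj_of_le h1 h2 h3 (f.injective.ne hne) (f.map_adj_iff.2 hxy))

/-- The vertices of a clique can be listed in increasing order. -/
lemma exists_perm_clique (h : IsSemiTransitiveOrder G le) {n : ℕ} (k : Fin n → V)
    (hk : ∀ i j, i ≠ j → G.Adj (k i) (k j)) :
    ∃ σ : Equiv.Perm (Fin n), ∀ i j, i ≤ j → le (k (σ i)) (k (σ j)) := by
  classical
  let r : Fin n → ℕ := fun i => (Finset.univ.filter fun j => le (k j) (k i)).card
  have hr : ∀ i j, r i ≤ r j → le (k i) (k j) := by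
    intro i j hij
    by_cases hne : i = j
    · exact hne ▸ h.refl _
    rcases h.total_of_adj (hk i j hne) with h1 | h1
    · exact h1
    · refine absurd hij (not_le.2 (Finset.card_lt_card ?_))
      refine Finset.ssubset_iff_subset_ne.2 ⟨fun l hl => ?_, fun heq => ?_⟩
      · simp only [Finset.mem_filter, Finset.mem_univ, true_and] at hl ⊢
        exact h.trans hl h1
      · have hi : i ∈ Finset.univ.filter fun l => le (k l) (k j) := by
          rw [heq]; simp [h.refl]
        simp only [Finset.mem_filter, Finset.mem_univ, true_and] at hi
        exact (hk i j hne).ne (h.antisymm hi h1)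
  exact ⟨Tuple.sort r, fun i j hij => hr _ _ (Tuple.monotone_sort r hij)⟩

variable {k : Fin 4 → V}

/-- A vertex adjacent to the first and third vertex of an increasing clique is adjacent to the
second or the fourth. -/
lemma not_adj_zero_two (h : IsSemiTransitiveOrder G le)
    (hk : ∀ i j, i ≠ j → G.Adj (k i) (k j)) (hle : ∀ i j, i ≤ j → le (k i) (k j)) {v : V}
    (h0 : G.Adj v (k 0)) (h2 : G.Adj v (k 2)) (h1 : ¬ G.Adj v (k 1)) (h3 : ¬ G.Adj v (k 3)) :
    False := by
  have e1 : v ≠ k 1 := by rintro rfl; exact h3 (hk 1 3 (by decide))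
  have e3 : v ≠ k 3 := by rintro rfl; exact h1 (hk 3 1 (by decide))
  rcases h.total_of_adj h0 with a0 | a0
  · exact h1 (h.adj_of_le (h.refl _) (h.trans a0 (hle 0 1 (by decide))) (hle 1 2 (by decide)) e1 h2)
  rcases h.total_of_adj h2 with a2 | a2
  · exact h3 (h.adj_of_le a0 (h.trans a2 (hle 2 3 (by decide))) (h.refl _) e3 (hk 0 3 (by decide)))
  · exact h1 (h.adj_of_le (hle 0 1 (by decide)) (h.trans (hle 1 2 (by decide)) a2) (h.refl _)
      e1.symm h0.symm).symm

/-- If a vertex misses only the first vertex of an increasing 4-clique, and another one only the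
third, then these two vertices are adjacent. -/
lemma adj_of_miss_zero_two (h : IsSemiTransitiveOrder G le)
    (hk : ∀ i j, i ≠ j → G.Adj (k i) (k j)) (hle : ∀ i j, i ≤ j → le (k i) (k j)) {u v : V}
    (u0 : ¬ G.Adj u (k 0)) (u1 : G.Adj u (k 1)) (u2 : G.Adj u (k 2)) (u3 : G.Adj u (k 3))
    (v0 : G.Adj v (k 0)) (v1 : G.Adj v (k 1)) (v2 : ¬ G.Adj v (k 2)) (v3 : G.Adj v (k 3)) :
    G.Adj u v := by
  by_cases eu : u = k 0
  · exact eu ▸ v0.symm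
  by_cases ev : v = k 2
  · exact ev ▸ u2
  have huv : u ≠ v := by rintro rfl; exact v2 u2
  -- `v` lies between the second and the fourth vertex of the clique
  have a1 : le (k 1) v := by
    refine (h.total_of_adj v1).resolve_left fun a => v2 ?_
    exact h.adj_of_le (h.refl _) (h.trans a (hle 1 2 (by decide))) (hle 2 3 (by decide)) ev v3
  have a3 : le v (k 3) := by
    refine (h.total_of_adj v3).resolve_right fun a => v2 (SimpleGraph.Adj.symm ?_)
    exact h.adj_of_le (hle 0 2 (by decide)) (h.trans (hle 2 3 (by decide)) a) (h.refl _)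
      (Ne.symm ev) v0.symm
  -- `u` lies below the second vertex or above the fourth
  rcases h.total_of_adj u1 with b1 | b1
  · exact h.adj_of_le (h.refl _) (h.trans b1 a1) a3 huv u3
  rcases h.total_of_adj u3 with b3 | b3
  · exact absurd (h.adj_of_le (h.refl _) (h.trans (hle 0 1 (by decide)) b1) b3 (Ne.symm eu)
      (hk 0 3 (by decide))).symm u0
  · exact (h.adj_of_le a1 (h.trans a3 b3) (h.refl _) huv.symm u1.symm).symm

end IsSemiTransitiveOrder

/-! ### The four graphs are not word-representable -/

/-- Vertices which prevent the clique `a, b, c, d` from being an increasing sequence in a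
semi-transitive order: one adjacent to `a` and `c` only, or two non-adjacent ones that miss only
`a` and only `c` respectively. -/
def OppositeObstruction {V : Type*} (G : SimpleGraph V) (a b c d : V) : Prop :=
  (∃ v, G.Adj v a ∧ G.Adj v c ∧ ¬ G.Adj v b ∧ ¬ G.Adj v d) ∨
  ∃ u v, ¬ G.Adj u a ∧ G.Adj u b ∧ G.Adj u c ∧ G.Adj u d ∧
    G.Adj v a ∧ G.Adj v b ∧ ¬ G.Adj v c ∧ G.Adj v d ∧ ¬ G.Adj u v

instance {V : Type*} [Fintype V] (G : SimpleGraph V) [DecidableRel G.Adj] (a b c d : V) :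
    Decidable (OppositeObstruction G a b c d) := by
  unfold OppositeObstruction; infer_instance

lemma IsSemiTransitiveOrder.not_oppositeObstruction {V : Type*} {G : SimpleGraph V}
    {le : V → V → Prop} (h : IsSemiTransitiveOrder G le) {k : Fin 4 → V}
    (hk : ∀ i j, i ≠ j → G.Adj (k i) (k j)) (hle : ∀ i j, i ≤ j → le (k i) (k j)) :
    ¬ OppositeObstruction G (k 0) (k 1) (k 2) (k 3) := by
  rintro (⟨v, h0, h2, h1, h3⟩ | ⟨u, v, u0, u1, u2, u3, v0, v1, v2, v3, huv⟩)
  · exact h.not_adj_zero_two hk hle h0 h2 h1 h3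
  · exact huv (h.adj_of_miss_zero_two hk hle u0 u1 u2 u3 v0 v1 v2 v3)

/-- A graph with an induced subgraph `H` is not word-representable if `H` has a 4-clique, every
ordering of which is obstructed when read forwards or backwards. -/
lemma not_wordRepresentable_of_oppositeObstruction {V W : Type*} {G : SimpleGraph V}
    {H : SimpleGraph W} (hHG : H.IsIndContained G) (k : Fin 4 → W)
    (hk : ∀ i j, i ≠ j → H.Adj (k i) (k j))
    (hobs : ∀ σ : Equiv.Perm (Fin 4),
      OppositeObstruction H (k (σ 0)) (k (σ 1)) (k (σ 2)) (k (σ 3)) ∨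
      OppositeObstruction H (k (σ 3)) (k (σ 2)) (k (σ 1)) (k (σ 0))) :
    ¬ WordRepresentable G := by
  rintro ⟨w, hw⟩
  obtain ⟨f⟩ := hHG
  have h := hw.isSemiTransitiveOrder.comap f
  obtain ⟨σ, hσ⟩ := h.exists_perm_clique k hk
  have hkσ : ∀ i j, i ≠ j → H.Adj (k (σ i)) (k (σ j)) :=
    fun i j hij => hk _ _ (σ.injective.ne hij)
  rcases hobs σ with h1 | h1
  · exact h.not_oppositeObstruction hkσ hσ h1
  · exact h.flip.not_oppositeObstruction (k := fun i => k (σ (Fin.rev i)))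
      (fun i j hij => hkσ _ _ (Fin.rev_injective.ne hij))
      (fun i j hij => hσ _ _ (Fin.rev_le_rev.2 hij)) h1

instance : DecidableRel splitT1.Adj := by unfold splitT1; infer_instance

instance : DecidableRel splitT2.Adj := by unfold splitT2; infer_instance

instance : DecidableRel splitT3.Adj := by unfold splitT3; infer_instance

instance : DecidableRel splitT4.Adj := by unfold splitT4; infer_instance

lemma not_wordRepresentable_of_splitT1 {V : Type*} {G : SimpleGraph V}
    (h : splitT1.IsIndContained G) : ¬ WordRepresentable G :=
  not_wordRepresentable_of_oppositeObstruction h ![0, 1, 2, 3] (by decide) (by decide +kernel)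

lemma not_wordRepresentable_of_splitT2 {V : Type*} {G : SimpleGraph V}
    (h : splitT2.IsIndContained G) : ¬ WordRepresentable G :=
  not_wordRepresentable_of_oppositeObstruction h ![0, 1, 2, 3] (by decide) (by decide +kernel)

lemma not_wordRepresentable_of_splitT3 {V : Type*} {G : SimpleGraph V}
    (h : splitT3.IsIndContained G) : ¬ WordRepresentable G :=
  not_wordRepresentable_of_oppositeObstruction h ![0, 1, 2, 3] (by decide) (by decide +kernel)

lemma not_wordRepresentable_of_splitT4 {V : Type*} {G : SimpleGraph V}
    (h : splitT4.IsIndContained G) : ¬ WordRepresentable G :=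
  not_wordRepresentable_of_oppositeObstruction h ![0, 1, 2, 3] (by decide) (by decide +kernel)

/-! ### A word for split graphs -/

section SplitWord

variable {V : Type*} (k : Fin 4 → V) (L M : List V) (a b : V → ℕ)

/-- A word representing a split graph with clique `k 0, k 1, k 2, k 3`, in which each vertex `v` of
`L` is adjacent to the `k i` with `a v ≤ i < b v`, and each vertex of `M` to `k 0` and `k 3`.
The clique is run through four times. The vertices of `L` are written before the first two runs, then
immediately after the clique vertex number `b v - 1` of the second run (at its beginning if
`b v = 0`) and immediately before number `a v` of the fourth run. The vertices of `M` occur once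
in each run, between `k 0` and `k 3`. -/
def splitWord : List V :=
  L ++ ([k 0] ++ M ++ [k 1, k 2, k 3]) ++ L.reverse ++
  (L.filter (b · = 0) ++ [k 0] ++ L.filter (b · = 1) ++ [k 1] ++ L.filter (b · = 2) ++ [k 2] ++
    L.filter (b · = 3) ++ M.reverse ++ [k 3] ++ L.filter (b · = 4)) ++
  ([k 0, k 1] ++ M ++ [k 2, k 3]) ++
  (L.filter (a · = 0) ++ [k 0] ++ M ++ L.filter (a · = 1) ++ [k 1] ++ L.filter (a · = 2) ++ [k 2] ++
    L.filter (a · = 3) ++ [k 3])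

variable {k L M a b}

open Classical in
lemma filter_pair_eq_nil {l : List V} {x y : V} (hx : x ∉ l) (hy : y ∉ l) :
    l.filter (fun c => c = x ∨ c = y) = [] := by
  rw [List.filter_eq_nil_iff]
  rintro c hc h
  rcases of_decide_eq_true h with rfl | rfl <;> contradiction

open Classical in
lemma filter_pair_eq_singleton {l : List V} (hl : l.Nodup) {x y : V} (hx : x ∈ l) (hy : y ∉ l) :
    l.filter (fun c => c = x ∨ c = y) = [x] := by
  have : l.filter (fun c => c = x ∨ c = y) = l.filter (fun c => c = x) :=
    List.filter_congr fun c hc => by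
      have : c ≠ y := by rintro rfl; exact hy hc
      simp [this]
  rw [this]
  exact (List.perm_singleton.1 ((List.perm_ext_iff_of_nodup (hl.filter _) (by simp)).2
    fun c => by simp; rintro rfl; exact hx))

/-- A list of letters followed by its reverse separates any two of them: the one that comes first is
skipped between the two copies of the other. -/
lemma not_lettersAlternate_of_reverse {w l B : List V} (hl : l.Nodup) {x y : V} (hx : x ∈ l)
    (hy : y ∈ l) (hxy : x ≠ y) (hxB : x ∉ B) (hyB : y ∉ B) (hw : l ++ B ++ l.reverse <:+: w) :
    ¬ LettersAlternate w x y := by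
  classical
  intro h
  obtain ⟨s, t, rfl⟩ := List.append_of_mem hx
  have hxs : x ∉ s ∧ x ∉ t := by grind
  rcases List.mem_append.1 hy with hy | hy
  · have := h.count_le_of_isInfix hxy (q := x :: t ++ B ++ t.reverse ++ [x])
      (.trans ⟨s, s.reverse, by simp⟩ hw)
    have hyt : y ∉ t := by grind
    simp [List.count_append, hxs, hyt, hyB, hxB, hxy,
      List.count_eq_zero_of_not_mem] at this
  · have hyt : y ∈ t := by grind
    have := (lettersAlternate_comm.1 h).count_le_of_isInfix hxy.symm (q := t ++ B ++ t.reverse)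
      (.trans ⟨s ++ [x], x :: s.reverse, by simp⟩ hw)
    have h1 := List.count_pos_iff.2 hyt
    simp only [List.count_append, List.count_reverse, List.count_eq_zero_of_not_mem hxs.2,
      List.count_eq_zero_of_not_mem hxB] at this
    omega

variable (hk : Function.Injective k) (hL : L.Nodup) (hM : M.Nodup) (hLM : L.Disjoint M)
  (hkL : ∀ i, k i ∉ L) (hkM : ∀ i, k i ∉ M)

include hk hkL hkM in
lemma splitWord_lettersAlternate_clique {i j : Fin 4} (hij : i < j) :
    LettersAlternate (splitWord k L M a b) (k i) (k j) := by
  classical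
  refine ⟨8, Or.inl ?_⟩
  have h0 (l : List V) (hl : l ⊆ L ∨ l ⊆ M) : l.filter (fun c => c = k i ∨ c = k j) = [] :=
    filter_pair_eq_nil (fun h => hl.elim (fun hl => hkL i (hl h)) fun hl => hkM i (hl h))
      (fun h => hl.elim (fun hl => hkL j (hl h)) fun hl => hkM j (hl h))
  have hF (f : V → ℕ) (n : ℕ) := h0 (L.filter (f · = n)) (Or.inl (List.filter_subset_self _))
  simp only [splitWord, List.filter_append, h0 L (by simp), h0 M (by simp), hF,
    h0 L.reverse (by simp), h0 M.reverse (by simp)]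
  fin_cases i <;> fin_cases j <;> simp_all [hk.eq_iff, altWord]

include hk hL hLM hkL hkM in
lemma splitWord_lettersAlternate_interval {v : V} (hv : v ∈ L) (hb : b v ≤ 4) {i : Fin 4}
    (hai : a v ≤ i) (hib : i < b v) :
    LettersAlternate (splitWord k L M a b) v (k i) := by
  classical
  refine ⟨8, Or.inl ?_⟩
  have hvk : ∀ j, k j ≠ v := fun j h => hkL j (h ▸ hv)
  have hM0 (l : List V) (hl : l ⊆ M) : l.filter (fun c => c = v ∨ c = k i) = [] :=
    filter_pair_eq_nil (fun h => hLM hv (hl h)) fun h => hkM i (hl h)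
  have hF (f : V → ℕ) (n : ℕ) : (L.filter (f · = n)).filter (fun c => c = v ∨ c = k i) =
      if f v = n then [v] else [] := by
    split_ifs with h
    · exact filter_pair_eq_singleton (hL.filter _) (by simp [hv, h]) (by simp [hkL])
    · exact filter_pair_eq_nil (by simp [h]) (by simp [hkL])
  simp only [splitWord, List.filter_append, hM0 M (by simp), hM0 M.reverse (by simp), hF,
    filter_pair_eq_singleton hL hv (hkL i),
    filter_pair_eq_singleton (List.nodup_reverse.2 hL) (List.mem_reverse.2 hv)
      (mt List.mem_reverse.1 (hkL i))]
  have ha : a v ≤ 3 := by omega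
  generalize a v = n at *
  generalize b v = m at *
  interval_cases n <;> interval_cases m <;> fin_cases i <;>
    first
      | exact absurd hai (by decide)
      | exact absurd hib (by decide)
      | simp [hk.eq_iff, altWord, hvk]

include hk hM hkM hLM hkL in
lemma splitWord_lettersAlternate_ends {u : V} (hu : u ∈ M) {i : Fin 4} (hi : i = 0 ∨ i = 3) :
    LettersAlternate (splitWord k L M a b) u (k i) := by
  classical
  have huk : ∀ j, k j ≠ u := fun j h => hkM j (h ▸ hu)
  have hL0 (l : List V) (hl : l ⊆ L) : l.filter (fun c => c = u ∨ c = k i) = [] :=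
    filter_pair_eq_nil (fun h => hLM (hl h) hu) fun h => hkL i (hl h)
  have hF (f : V → ℕ) (n : ℕ) := hL0 (L.filter (f · = n)) (List.filter_subset_self _)
  refine ⟨8, ?_⟩
  simp only [splitWord, List.filter_append, hL0 L (by simp), hL0 L.reverse (by simp), hF,
    filter_pair_eq_singleton hM hu (hkM i),
    filter_pair_eq_singleton (List.nodup_reverse.2 hM) (List.mem_reverse.2 hu)
      (mt List.mem_reverse.1 (hkM i))]
  rcases hi with rfl | rfl
  · right; simp [hk.eq_iff, altWord, huk]
  · left; simp [hk.eq_iff, altWord, huk]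

/-- A letter with two copies between which another letter does not occur does not alternate with
the latter. -/
lemma not_lettersAlternate_of_mem {w l₁ B l₂ : List V} {x y : V} (hw : l₁ ++ B ++ l₂ <:+: w)
    (hx₁ : x ∈ l₁) (hx₂ : x ∈ l₂) (hy : y ∉ l₁ ++ B ++ l₂) : ¬ LettersAlternate w x y := by
  classical
  intro h
  have hxy : x ≠ y := by
    rintro rfl
    exact hy (by simp [hx₁])
  have := h.count_le_of_isInfix hxy hw
  rw [List.count_eq_zero_of_not_mem hy, List.count_append, List.count_append] at this
  have := List.count_pos_iff.2 hx₁
  have := List.count_pos_iff.2 hx₂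
  omega

include hL hLM hkL in
lemma splitWord_not_lettersAlternate_of_mem_left {v v' : V} (hv : v ∈ L) (hv' : v' ∈ L)
    (hne : v ≠ v') : ¬ LettersAlternate (splitWord k L M a b) v v' := by
  have h (v : V) (hv : v ∈ L) : v ∉ [k 0] ++ M ++ [k 1, k 2, k 3] := by
    have : ∀ i, v ≠ k i := fun i h => hkL i (h ▸ hv)
    simp [this, show v ∉ M from hLM hv]
  exact not_lettersAlternate_of_reverse hL hv hv' hne (h v hv) (h v' hv')
    ⟨[], _, by simp only [splitWord, List.append_assoc, List.nil_append]; rfl⟩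

include hM hLM hkM in
lemma splitWord_not_lettersAlternate_of_mem_right {u u' : V} (hu : u ∈ M) (hu' : u' ∈ M)
    (hne : u ≠ u') : ¬ LettersAlternate (splitWord k L M a b) u u' := by
  have h (u : V) (hu : u ∈ M) : u ∉ [k 1, k 2, k 3] ++ L.reverse ++ L.filter (b · = 0) ++ [k 0] ++
      L.filter (b · = 1) ++ [k 1] ++ L.filter (b · = 2) ++ [k 2] ++ L.filter (b · = 3) := by
    have h1 : ∀ i, u ≠ k i := fun i h => hkM i (h ▸ hu)
    have h2 : u ∉ L := fun h => hLM h hu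
    simp [h1, h2]
  exact not_lettersAlternate_of_reverse hM hu hu' hne (h u hu) (h u' hu')
    ⟨L ++ [k 0], _, by
      simp only [splitWord, List.append_assoc, List.cons_append, List.nil_append]; rfl⟩

/-- Between its copies before and in the second run, `v ∈ L` is passed by the first `b v` clique
vertices only. -/
lemma splitWord_not_lettersAlternate_of_early {v y : V} (hv : v ∈ L) (hb : b v ≤ 3) (hy : y ∉ L)
    (hyk : ∀ i : Fin 4, i < b v → y ≠ k i) :
    ¬ LettersAlternate (splitWord k L M a b) v y := by
  obtain h | h | h | h : b v = 0 ∨ b v = 1 ∨ b v = 2 ∨ b v = 3 := by omega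
  · refine not_lettersAlternate_of_mem (l₁ := L.reverse) (B := []) (l₂ := L.filter (b · = 0))
      ⟨L ++ ([k 0] ++ M ++ [k 1, k 2, k 3]), _, by
        simp only [splitWord, List.append_assoc, List.cons_append, List.nil_append]; rfl⟩
      (by simpa) (by simp [hv, h]) (by simp [hy])
  · have := hyk 0 (by simp [h])
    refine not_lettersAlternate_of_mem (l₁ := L.reverse) (B := L.filter (b · = 0) ++ [k 0])
      (l₂ := L.filter (b · = 1))
      ⟨L ++ ([k 0] ++ M ++ [k 1, k 2, k 3]), _, by
        simp only [splitWord, List.append_assoc, List.cons_append, List.nil_append]; rfl⟩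
      (by simpa) (by simp [hv, h]) (by simp [hy, this])
  · have h0 := hyk 0 (by simp [h])
    have h1 := hyk 1 (by simp [h])
    refine not_lettersAlternate_of_mem (l₁ := L.reverse)
      (B := L.filter (b · = 0) ++ [k 0] ++ L.filter (b · = 1) ++ [k 1])
      (l₂ := L.filter (b · = 2))
      ⟨L ++ ([k 0] ++ M ++ [k 1, k 2, k 3]), _, by
        simp only [splitWord, List.append_assoc, List.cons_append, List.nil_append]; rfl⟩
      (by simpa) (by simp [hv, h]) (by simp [hy, h0, h1])
  · have h0 := hyk 0 (by simp [h])
    have h1 := hyk 1 (by simp [h])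
    have h2 := hyk 2 (by simp [h])
    refine not_lettersAlternate_of_mem (l₁ := L.reverse)
      (B := L.filter (b · = 0) ++ [k 0] ++ L.filter (b · = 1) ++ [k 1] ++ L.filter (b · = 2) ++ [k 2])
      (l₂ := L.filter (b · = 3))
      ⟨L ++ ([k 0] ++ M ++ [k 1, k 2, k 3]), _, by
        simp only [splitWord, List.append_assoc, List.cons_append, List.nil_append]; rfl⟩
      (by simpa) (by simp [hv, h]) (by simp [hy, h0, h1, h2])

include hLM hkL in
/-- Between the third run and its copy in the fourth, `v ∈ L` does not occur, while the first `a v`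
clique vertices occur twice. -/
lemma splitWord_not_lettersAlternate_of_late {v : V} (hv : v ∈ L) (ha : a v ≤ 3) {i : Fin 4}
    (hi : i < a v) : ¬ LettersAlternate (splitWord k L M a b) v (k i) := by
  rw [lettersAlternate_comm]
  have hvk : ∀ i, v ≠ k i := fun i h => hkL i (h ▸ hv)
  have hvM : v ∉ M := hLM hv
  let P := L ++ ([k 0] ++ M ++ [k 1, k 2, k 3]) ++ L.reverse ++
    (L.filter (b · = 0) ++ [k 0] ++ L.filter (b · = 1) ++ [k 1] ++ L.filter (b · = 2) ++ [k 2] ++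
    L.filter (b · = 3) ++ M.reverse ++ [k 3] ++ L.filter (b · = 4))
  obtain rfl | rfl | rfl | rfl : i = 0 ∨ i = 1 ∨ i = 2 ∨ i = 3 := by
    clear hi; revert i; decide
  · refine not_lettersAlternate_of_mem (l₁ := [k 0])
      (B := [k 1] ++ M ++ [k 2, k 3] ++ L.filter (a · = 0)) (l₂ := [k 0])
      ⟨P, _, by
        simp only [P, splitWord, List.append_assoc, List.cons_append, List.nil_append]; rfl⟩
      (by simp) (by simp) ?_
    have : a v ≠ 0 := by rintro h; simp [h] at hi
    simp [hvk, hvM, this]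
  · refine not_lettersAlternate_of_mem (l₁ := [k 1])
      (B := M ++ [k 2, k 3] ++ L.filter (a · = 0) ++ [k 0] ++ M ++ L.filter (a · = 1))
      (l₂ := [k 1])
      ⟨P ++ [k 0], _, by
        simp only [P, splitWord, List.append_assoc, List.cons_append, List.nil_append]; rfl⟩
      (by simp) (by simp) ?_
    have h0 : a v ≠ 0 := by rintro h; simp [h] at hi
    have h1 : a v ≠ 1 := by rintro h; simp [h] at hi
    simp [hvk, hvM, h0, h1]
  · refine not_lettersAlternate_of_mem (l₁ := [k 2])
      (B := [k 3] ++ L.filter (a · = 0) ++ [k 0] ++ M ++ L.filter (a · = 1) ++ [k 1] ++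
        L.filter (a · = 2))
      (l₂ := [k 2])
      ⟨P ++ [k 0, k 1] ++ M, _, by
        simp only [P, splitWord, List.append_assoc, List.cons_append, List.nil_append]; rfl⟩
      (by simp) (by simp) ?_
    have h0 : a v ≠ 0 := by rintro h; simp [h] at hi
    have h1 : a v ≠ 1 := by rintro h; simp [h] at hi
    have h2 : a v ≠ 2 := by rintro h; simp [h] at hi
    simp [hvk, hvM, h0, h1, h2]
  · exact absurd ha (not_le.2 hi)

include hLM hkM in
lemma splitWord_not_lettersAlternate_middle {u : V} (hu : u ∈ M) {i : Fin 4} (hi : i = 1 ∨ i = 2) :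
    ¬ LettersAlternate (splitWord k L M a b) u (k i) := by
  rw [lettersAlternate_comm]
  have huk : ∀ i, u ≠ k i := fun i h => hkM i (h ▸ hu)
  have huL : u ∉ L := fun h => hLM h hu
  rcases hi with rfl | rfl
  · exact not_lettersAlternate_of_mem (l₁ := [k 1])
      (B := [k 2, k 3] ++ L.reverse ++ L.filter (b · = 0) ++ [k 0] ++ L.filter (b · = 1))
      (l₂ := [k 1])
      ⟨L ++ [k 0] ++ M, _, by
        simp only [splitWord, List.append_assoc, List.cons_append, List.nil_append]; rfl⟩
      (by simp) (by simp) (by simp [huk, huL])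
  · exact not_lettersAlternate_of_mem (l₁ := [k 2])
      (B := [k 3] ++ L.reverse ++ L.filter (b · = 0) ++ [k 0] ++ L.filter (b · = 1) ++ [k 1] ++
        L.filter (b · = 2))
      (l₂ := [k 2])
      ⟨L ++ [k 0] ++ M ++ [k 1], _, by
        simp only [splitWord, List.append_assoc, List.cons_append, List.nil_append]; rfl⟩
      (by simp) (by simp) (by simp [huk, huL])

include hLM hkL hkM in
lemma splitWord_not_lettersAlternate_of_mem_left_right {v u : V} (hv : v ∈ L) (hu : u ∈ M)
    (hb : b v ≤ 4) (hab : a v = 0 → b v ≠ 4) :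
    ¬ LettersAlternate (splitWord k L M a b) v u := by
  by_cases hb3 : b v ≤ 3
  · exact splitWord_not_lettersAlternate_of_early hv hb3 (fun h => hLM h hu)
      fun i _ h => hkM i (h ▸ hu)
  · have ha : a v ≠ 0 := fun h => hab h (by omega)
    have hvk : ∀ i, v ≠ k i := fun i h => hkL i (h ▸ hv)
    rw [lettersAlternate_comm]
    -- `v` does not occur between the copies of `u` in the third and in the fourth run
    exact not_lettersAlternate_of_mem (l₁ := M)
      (B := [k 2, k 3] ++ L.filter (a · = 0) ++ [k 0]) (l₂ := M)
      ⟨L ++ ([k 0] ++ M ++ [k 1, k 2, k 3]) ++ L.reverse ++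
        (L.filter (b · = 0) ++ [k 0] ++ L.filter (b · = 1) ++ [k 1] ++ L.filter (b · = 2) ++ [k 2] ++
        L.filter (b · = 3) ++ M.reverse ++ [k 3] ++ L.filter (b · = 4)) ++ [k 0, k 1], _, by
        simp only [splitWord, List.append_assoc, List.cons_append, List.nil_append]; rfl⟩
      hu hu (by simp [hvk, show v ∉ M from hLM hv, ha])

end SplitWord

/-! ### Representability of a well-arranged split graph -/

/-- A vertex outside a 4-clique whose neighbourhood in the clique is neither everything nor one of
four forbidden sets is adjacent to the two ends of the clique, or to the vertices of an interval. -/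
lemma ends_or_interval (f : Fin 4 → Bool) (h : ¬ ∀ i, f i)
    (h02 : ¬ (f 0 ∧ ¬ f 1 ∧ f 2 ∧ ¬ f 3)) (h13 : ¬ (¬ f 0 ∧ f 1 ∧ ¬ f 2 ∧ f 3))
    (h013 : ¬ (f 0 ∧ f 1 ∧ ¬ f 2 ∧ f 3)) (h023 : ¬ (f 0 ∧ ¬ f 1 ∧ f 2 ∧ f 3)) :
    (∀ i, f i ↔ i = 0 ∨ i = 3) ∨
      ∃ (a : Fin 4) (b : Fin 5), (a = 0 → b ≠ 4) ∧
        ∀ i : Fin 4, f i ↔ a.val ≤ i.val ∧ i.val < b.val := by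
  revert f; decide

/-- A split graph is word-representable if its 4-clique can be arranged such that the vertices
outside avoid four neighbourhoods. -/
lemma wordRepresentable_of_arrangement {V : Type*} [Finite V] {G : SimpleGraph V} (k : Fin 4 → V)
    (hk : ∀ i j, i ≠ j → G.Adj (k i) (k j))
    (hind : ∀ u v, u ∉ Set.range k → v ∉ Set.range k → ¬ G.Adj u v)
    (hmax : ∀ v, v ∉ Set.range k → ¬ ∀ i, G.Adj v (k i))
    (h02 : ∀ v, v ∉ Set.range k →
      ¬ (G.Adj v (k 0) ∧ ¬ G.Adj v (k 1) ∧ G.Adj v (k 2) ∧ ¬ G.Adj v (k 3)))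
    (h13 : ∀ v, v ∉ Set.range k →
      ¬ (¬ G.Adj v (k 0) ∧ G.Adj v (k 1) ∧ ¬ G.Adj v (k 2) ∧ G.Adj v (k 3)))
    (h013 : ∀ v, v ∉ Set.range k →
      ¬ (G.Adj v (k 0) ∧ G.Adj v (k 1) ∧ ¬ G.Adj v (k 2) ∧ G.Adj v (k 3)))
    (h023 : ∀ v, v ∉ Set.range k →
      ¬ (G.Adj v (k 0) ∧ ¬ G.Adj v (k 1) ∧ G.Adj v (k 2) ∧ G.Adj v (k 3))) :
    WordRepresentable G := by
  classical
  have := Fintype.ofFinite V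
  have hinj : Function.Injective k := fun i j h => by
    by_contra hij
    exact (hk i j hij).ne h
  have htype : ∀ v, v ∉ Set.range k → (∀ i, G.Adj v (k i) ↔ i = 0 ∨ i = 3) ∨
      ∃ (a : Fin 4) (b : Fin 5), (a = 0 → b ≠ 4) ∧
        ∀ i : Fin 4, G.Adj v (k i) ↔ a.val ≤ i.val ∧ i.val < b.val := by
    intro v hv
    simpa using ends_or_interval (fun i => decide (G.Adj v (k i))) (by simpa using hmax v hv)
      (by simpa using h02 v hv) (by simpa using h13 v hv) (by simpa using h013 v hv)
      (by simpa using h023 v hv)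
  have hint : ∀ v, ∃ a b : ℕ, v ∉ Set.range k → ¬ (∀ i, G.Adj v (k i) ↔ i = 0 ∨ i = 3) →
      a ≤ 3 ∧ b ≤ 4 ∧ (a = 0 → b ≠ 4) ∧ ∀ i : Fin 4, G.Adj v (k i) ↔ a ≤ i.val ∧ i.val < b := by
    intro v
    by_cases hv : v ∉ Set.range k ∧ ¬ (∀ i, G.Adj v (k i) ↔ i = 0 ∨ i = 3)
    · obtain ⟨a, b, hab, h⟩ := (htype v hv.1).resolve_left hv.2
      exact ⟨a, b, fun _ _ => ⟨by omega, by omega, by omega, h⟩⟩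
    · exact ⟨0, 0, fun h1 h2 => absurd ⟨h1, h2⟩ hv⟩
  choose a b hab using hint
  let L : List V := (Finset.univ.filter fun v =>
    v ∉ Set.range k ∧ ¬ (∀ i, G.Adj v (k i) ↔ i = 0 ∨ i = 3)).toList
  let M : List V := (Finset.univ.filter fun v =>
    v ∉ Set.range k ∧ ∀ i, G.Adj v (k i) ↔ i = 0 ∨ i = 3).toList
  have memL : ∀ v, v ∈ L ↔ v ∉ Set.range k ∧ ¬ (∀ i, G.Adj v (k i) ↔ i = 0 ∨ i = 3) := by
    intro v; simp only [L, Finset.mem_toList, Finset.mem_filter, Finset.mem_univ, true_and]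
  have memM : ∀ v, v ∈ M ↔ v ∉ Set.range k ∧ ∀ i, G.Adj v (k i) ↔ i = 0 ∨ i = 3 := by
    intro v; simp only [M, Finset.mem_toList, Finset.mem_filter, Finset.mem_univ, true_and]
  have hL : L.Nodup := Finset.nodup_toList _
  have hM : M.Nodup := Finset.nodup_toList _
  have hLM : L.Disjoint M := fun v h1 h2 => ((memL v).1 h1).2 ((memM v).1 h2).2
  have hkL : ∀ i, k i ∉ L := fun i h => ((memL _).1 h).1 ⟨i, rfl⟩
  have hkM : ∀ i, k i ∉ M := fun i h => ((memM _).1 h).1 ⟨i, rfl⟩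
  have hcases : ∀ v, v ∈ Set.range k ∨ v ∈ L ∨ v ∈ M := by
    intro v
    rw [memL, memM]
    by_cases h1 : v ∈ Set.range k
    · exact .inl h1
    · by_cases h2 : ∀ i, G.Adj v (k i) ↔ i = 0 ∨ i = 3
      · exact .inr (.inr ⟨h1, h2⟩)
      · exact .inr (.inl ⟨h1, h2⟩)
  have hLk : ∀ v ∈ L, ∀ i, LettersAlternate (splitWord k L M a b) v (k i) ↔ G.Adj v (k i) := by
    intro v hv i
    obtain ⟨ha, hb, h04, h⟩ := hab v ((memL v).1 hv).1 ((memL v).1 hv).2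
    rw [h]
    refine ⟨fun halt => ⟨?_, ?_⟩, fun hi =>
      splitWord_lettersAlternate_interval hinj hL hLM hkL hkM hv hb hi.1 hi.2⟩
    · by_contra! hi
      exact splitWord_not_lettersAlternate_of_late hLM hkL hv ha hi halt
    · by_contra! hi
      refine splitWord_not_lettersAlternate_of_early hv (by omega) (hkL i) (fun j hj hji => ?_) halt
      rw [hinj hji] at hi
      omega
  have hMk : ∀ u ∈ M, ∀ i, LettersAlternate (splitWord k L M a b) u (k i) ↔ G.Adj u (k i) := by
    intro u hu i
    rw [((memM u).1 hu).2]
    refine ⟨fun halt => ?_, splitWord_lettersAlternate_ends hinj hM hLM hkL hkM hu⟩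
    by_contra hi
    refine splitWord_not_lettersAlternate_middle hLM hkM hu (i := i) ?_ halt
    clear halt; revert i; decide
  have hLM' : ∀ v ∈ L, ∀ u ∈ M, ¬ LettersAlternate (splitWord k L M a b) v u := by
    intro v hv u hu
    obtain ⟨-, hb, h04, -⟩ := hab v ((memL v).1 hv).1 ((memL v).1 hv).2
    exact splitWord_not_lettersAlternate_of_mem_left_right hLM hkL hkM hv hu hb h04
  have hkk : ∀ i j, i ≠ j → LettersAlternate (splitWord k L M a b) (k i) (k j) := by
    intro i j hij
    rcases lt_or_gt_of_ne hij with h | h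
    · exact splitWord_lettersAlternate_clique hinj hkL hkM h
    · exact lettersAlternate_comm.1 (splitWord_lettersAlternate_clique hinj hkL hkM h)
  have hout : ∀ v, v ∈ L ∨ v ∈ M → v ∉ Set.range k := fun v hv =>
    hv.elim (fun h => ((memL v).1 h).1) fun h => ((memM v).1 h).1
  refine ⟨splitWord k L M a b, fun v => ?_, fun x y hxy => ?_⟩
  · rcases hcases v with ⟨i, rfl⟩ | hv | hv
    · have : i = 0 ∨ i = 1 ∨ i = 2 ∨ i = 3 := by revert i; decide
      rcases this with rfl | rfl | rfl | rfl <;> simp [splitWord]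
    · simp [splitWord, hv]
    · simp [splitWord, hv]
  · rcases hcases x with ⟨i, rfl⟩ | hx | hx <;> rcases hcases y with ⟨j, rfl⟩ | hy | hy
    · have hij : i ≠ j := fun h => hxy (h ▸ rfl)
      exact iff_of_true (hkk i j hij) (hk i j hij)
    · rw [lettersAlternate_comm, G.adj_comm, hLk y hy]
    · rw [lettersAlternate_comm, G.adj_comm, hMk y hy]
    · exact hLk x hx j
    · exact iff_of_false (splitWord_not_lettersAlternate_of_mem_left hL hLM hkL hx hy hxy)
        (hind x y (hout x (.inl hx)) (hout y (.inl hy)))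
    · exact iff_of_false (hLM' x hx y hy) (hind x y (hout x (.inl hx)) (hout y (.inr hy)))
    · exact hMk x hx j
    · rw [lettersAlternate_comm]
      exact iff_of_false (hLM' y hy x hx) (hind x y (hout x (.inr hx)) (hout y (.inl hy)))
    · exact iff_of_false (splitWord_not_lettersAlternate_of_mem_right hM hLM hkM hx hy hxy)
        (hind x y (hout x (.inr hx)) (hout y (.inr hy)))

/-! ### Arranging the clique -/

/-- The combinatorial core of the construction: `p a b` says that `{a, b}` is a neighbourhood in the
clique `Fin 4`, and `t a` that the complement of `{a}` is one. The vertices are to be placed on a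
4-cycle `a, b, c, d` such that the pairs in `p` are consecutive and the vertices in `t` are among the
consecutive `a`, `d`. -/
lemma exists_arrangement (p : Fin 4 → Fin 4 → Prop) (t : Fin 4 → Prop)
    (hp : ∀ a b, p a b → p b a)
    (h_triangle : ∀ a b c d, [a, b, c, d].Nodup → ¬ (p a b ∧ p a c ∧ p b c))
    (h_star : ∀ a b c d, [a, b, c, d].Nodup → ¬ (p a b ∧ p a c ∧ p a d))
    (h_three : ∀ a b c d, [a, b, c, d].Nodup → ¬ (t b ∧ t c ∧ t d))
    (h_ends : ∀ a b c d, [a, b, c, d].Nodup → ¬ (p a b ∧ p a d ∧ t b ∧ t d))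
    (h_centre : ∀ a b c d, [a, b, c, d].Nodup → ¬ (p a b ∧ p a d ∧ t a ∧ t c)) :
    ∃ a b c d, [a, b, c, d].Nodup ∧ ¬ p a c ∧ ¬ p b d ∧ ¬ t b ∧ ¬ t c := by
  by_contra! hcon
  by_cases h : ∃ a d, a ≠ d ∧ t a ∧ t d
  · -- `a` and `d` are prescribed, and only the order of the other two is left to choose
    obtain ⟨a, d, had, ta, td⟩ := h
    obtain ⟨b, c, hn⟩ : ∃ b c, [a, b, c, d].Nodup := by
      clear ta td; revert a d; decide
    have tb : ¬ t b := fun tb => h_three c a b d (by clear * - hn; grind) ⟨ta, tb, td⟩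
    have tc : ¬ t c := fun tc => h_three b a c d (by clear * - hn; grind) ⟨ta, tc, td⟩
    have h1 : p a c ∨ p b d := by
      by_contra! h; exact tc (hcon a b c d hn h.1 h.2 tb)
    have h2 : p a b ∨ p c d := by
      by_contra! h; exact tb (hcon a c b d (by clear * - hn; grind) h.1 h.2 tc)
    rcases h1 with h1 | h1 <;> rcases h2 with h2 | h2
    · exact h_centre a b d c (by clear * - hn; grind) ⟨h2, h1, ta, td⟩
    · exact h_ends c a b d (by clear * - hn; grind) ⟨hp _ _ h1, h2, ta, td⟩
    · exact h_ends b a c d (by clear * - hn; grind) ⟨hp _ _ h2, h1, ta, td⟩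
    · exact h_centre d b a c (by clear * - hn; grind) ⟨hp _ _ h1, hp _ _ h2, td, ta⟩
  · push Not at h
    -- at most one vertex is in `t`; it can be taken as `a`, and any pairing can be realized
    obtain ⟨a, ha⟩ : ∃ a, ∀ b, a ≠ b → ¬ t b := by
      by_cases h0 : ∃ a, t a
      · obtain ⟨a, ta⟩ := h0
        exact ⟨a, fun b hb => h a b hb ta⟩
      · exact ⟨0, fun b _ tb => h0 ⟨b, tb⟩⟩
    obtain ⟨b, c, d, hn⟩ : ∃ b c d, [a, b, c, d].Nodup := by
      clear ha; revert a; decide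
    have tb : ¬ t b := ha b (by clear * - hn; grind)
    have tc : ¬ t c := ha c (by clear * - hn; grind)
    have td : ¬ t d := ha d (by clear * - hn; grind)
    -- each of the three perfect matchings of the clique contains a pair in `p`
    have h1 : p a c ∨ p b d := by
      by_contra! h; exact tc (hcon a b c d hn h.1 h.2 tb)
    have h2 : p a b ∨ p c d := by
      by_contra! h; exact tb (hcon a c b d (by clear * - hn; grind) h.1 h.2 tc)
    have h3 : p a d ∨ p b c := by
      by_contra! h; exact td (hcon a b d c (by clear * - hn; grind) h.1 h.2 tb)
    -- one pair out of each perfect matching: four triangles and four stars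
    rcases h1 with h1 | h1 <;> rcases h2 with h2 | h2 <;> rcases h3 with h3 | h3
    · exact h_star a b c d (by clear * - hn; grind) ⟨h2, h1, h3⟩
    · exact h_triangle a b c d (by clear * - hn; grind) ⟨h2, h1, h3⟩
    · exact h_triangle a c d b (by clear * - hn; grind) ⟨h1, h3, h2⟩
    · exact h_star c a b d (by clear * - hn; grind) ⟨hp _ _ h1, hp _ _ h3, h2⟩
    · exact h_triangle a b d c (by clear * - hn; grind) ⟨h2, h3, h1⟩
    · exact h_star b a c d (by clear * - hn; grind) ⟨hp _ _ h2, h3, h1⟩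
    · exact h_star d a b c (by clear * - hn; grind) ⟨hp _ _ h3, hp _ _ h1, hp _ _ h2⟩
    · exact h_triangle b c d a (by clear * - hn; grind) ⟨h3, h1, h2⟩

/-! ### Finding the four graphs as induced subgraphs -/

/-- A split graph `H` on `4 + m` vertices is an induced subgraph of `G` as soon as its clique and
its independent vertices can be mapped to `G` with the right adjacencies; `s i j` says whether the
`i`-th independent vertex is adjacent to the `j`-th vertex of the clique. The map is injective because
no two vertices of `H` have the same neighbours. -/
lemma isIndContained_of_split {V : Type*} {G : SimpleGraph V} {m : ℕ} {H : SimpleGraph (Fin (4 + m))}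
    (hH : ∀ i j, (∀ l, H.Adj i l ↔ H.Adj j l) → i = j)
    (hHc : ∀ i j : Fin 4, H.Adj (Fin.castAdd m i) (Fin.castAdd m j) ↔ i ≠ j)
    (hHx : ∀ i j : Fin m, ¬ H.Adj (Fin.natAdd 4 i) (Fin.natAdd 4 j))
    (s : Fin m → Fin 4 → Bool)
    (hHs : ∀ i j, H.Adj (Fin.natAdd 4 i) (Fin.castAdd m j) ↔ s i j)
    (c : Fin 4 → V) (x : Fin m → V) (hc : ∀ i j, i ≠ j → G.Adj (c i) (c j))
    (hx : ∀ i j, ¬ G.Adj (x i) (x j))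
    (hxs : ∀ i j, G.Adj (x i) (c j) ↔ s i j) :
    H.IsIndContained G := by
  have hcc : ∀ i j, G.Adj (c i) (c j) ↔ i ≠ j :=
    fun i j => ⟨fun h hij => G.loopless.irrefl _ (hij ▸ h), hc i j⟩
  have hadj : ∀ i j, G.Adj (Fin.append c x i) (Fin.append c x j) ↔ H.Adj i j := by
    intro i j
    induction i using Fin.addCases with
    | left i =>
      induction j using Fin.addCases with
      | left j => simp only [Fin.append_left, hcc, hHc]
      | right j => rw [Fin.append_left, Fin.append_right, G.adj_comm, H.adj_comm, hxs, hHs]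
    | right i =>
      induction j using Fin.addCases with
      | left j => rw [Fin.append_left, Fin.append_right, hxs, hHs]
      | right j => simp only [Fin.append_right, hx, hHx]
  refine ⟨⟨⟨Fin.append c x, fun i j hij => hH i j fun l => ?_⟩, hadj _ _⟩⟩
  rw [← hadj, ← hadj, hij]


section Embeddings

variable {V : Type*} {G : SimpleGraph V} (c : Fin 4 → V) (hc : ∀ i j, i ≠ j → G.Adj (c i) (c j))

include hc

lemma splitT1_isIndContained (x : Fin 3 → V) (hx : ∀ i j, ¬ G.Adj (x i) (x j))
    (hxc : ∀ i j, G.Adj (x i) (c j) ↔ ![![true, true, false, false], ![true, false, true, false],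
      ![false, true, true, false]] i j) : splitT1.IsIndContained G :=
  isIndContained_of_split (m := 3) (by decide) (by decide) (by decide) _ (by decide) c x hc hx hxc

lemma splitT2_isIndContained (x : Fin 3 → V) (hx : ∀ i j, ¬ G.Adj (x i) (x j))
    (hxc : ∀ i j, G.Adj (x i) (c j) ↔ ![![true, true, false, false], ![true, false, true, false],
      ![true, false, false, true]] i j) : splitT2.IsIndContained G :=
  isIndContained_of_split (m := 3) (by decide) (by decide) (by decide) _ (by decide) c x hc hx hxc

lemma splitT3_isIndContained (x : Fin 3 → V) (hx : ∀ i j, ¬ G.Adj (x i) (x j))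
    (hxc : ∀ i j, G.Adj (x i) (c j) ↔ ![![true, true, true, false], ![true, true, false, true],
      ![true, false, true, true]] i j) : splitT3.IsIndContained G :=
  isIndContained_of_split (m := 3) (by decide) (by decide) (by decide) _ (by decide) c x hc hx hxc

lemma splitT4_isIndContained (x : Fin 4 → V) (hx : ∀ i j, ¬ G.Adj (x i) (x j))
    (hxc : ∀ i j, G.Adj (x i) (c j) ↔ ![![true, true, false, false], ![true, false, false, true],
      ![true, true, true, false], ![true, false, true, true]] i j) : splitT4.IsIndContained G :=
  isIndContained_of_split (m := 4) (by decide) (by decide) (by decide) _ (by decide) c x hc hx hxc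

end Embeddings

lemma adj_vecCons_four {V : Type*} {G : SimpleGraph V} {c₀ c₁ c₂ c₃ : V} (h₀₁ : G.Adj c₀ c₁)
    (h₀₂ : G.Adj c₀ c₂) (h₀₃ : G.Adj c₀ c₃) (h₁₂ : G.Adj c₁ c₂) (h₁₃ : G.Adj c₁ c₃)
    (h₂₃ : G.Adj c₂ c₃) (i j : Fin 4) (hij : i ≠ j) :
    G.Adj (![c₀, c₁, c₂, c₃] i) (![c₀, c₁, c₂, c₃] j) := by
  fin_cases i <;> fin_cases j <;> first | exact absurd rfl hij | assumption | (symm; assumption)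

/-- Some vertex outside the clique `k` is adjacent in it to `k a` and `k b` only. -/
def PairTrace {V : Type*} (G : SimpleGraph V) (k : Fin 4 → V) (a b : Fin 4) : Prop :=
  ∃ x ∉ Set.range k, ∀ l, G.Adj x (k l) ↔ l = a ∨ l = b

/-- Some vertex outside the clique `k` is adjacent to all its vertices except `k a`. -/
def CoTrace {V : Type*} (G : SimpleGraph V) (k : Fin 4 → V) (a : Fin 4) : Prop :=
  ∃ x ∉ Set.range k, ∀ l, G.Adj x (k l) ↔ l ≠ a

lemma PairTrace.symm {V : Type*} {G : SimpleGraph V} {k : Fin 4 → V} {a b : Fin 4}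
    (h : PairTrace G k a b) : PairTrace G k b a := by
  obtain ⟨x, hx, h⟩ := h
  exact ⟨x, hx, fun l => by rw [h, or_comm]⟩

lemma nodup_four_iff {α : Type*} {a b c d : α} :
    [a, b, c, d].Nodup ↔ a ≠ b ∧ a ≠ c ∧ a ≠ d ∧ b ≠ c ∧ b ≠ d ∧ c ≠ d := by
  simp [and_assoc]

section Traces

variable {V : Type*} {G : SimpleGraph V} {k : Fin 4 → V} {a b c d : Fin 4}
  (hk : ∀ i j, i ≠ j → G.Adj (k i) (k j))
  (hind : ∀ u v, u ∉ Set.range k → v ∉ Set.range k → ¬ G.Adj u v)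
  (hn : [a, b, c, d].Nodup)

include hk hn in
lemma adj_of_nodup (i j : Fin 4) (hij : i ≠ j) :
    G.Adj (![k a, k b, k c, k d] i) (![k a, k b, k c, k d] j) := by
  obtain ⟨h1, h2, h3, h4, h5, h6⟩ := nodup_four_iff.1 hn
  exact adj_vecCons_four (hk _ _ h1) (hk _ _ h2) (hk _ _ h3) (hk _ _ h4) (hk _ _ h5) (hk _ _ h6)
    i j hij

include hk hind hn

lemma splitT1_isIndContained_of_triangle (hab : PairTrace G k a b) (hac : PairTrace G k a c)
    (hbc : PairTrace G k b c) : splitT1.IsIndContained G := by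
  obtain ⟨⟨x, hx, hx'⟩, ⟨y, hy, hy'⟩, ⟨z, hz, hz'⟩⟩ := And.intro hab (And.intro hac hbc)
  refine splitT1_isIndContained _ (adj_of_nodup hk hn) ![x, y, z] ?_ ?_
  · intro i j; fin_cases i <;> fin_cases j <;> exact hind _ _ ‹_› ‹_›
  · obtain ⟨h1, h2, h3, h4, h5, h6⟩ := nodup_four_iff.1 hn
    intro i j; fin_cases i <;> fin_cases j <;>
      simp [hx', hy', hz', h1, h2, h4, h1.symm, h2.symm, h3.symm, h4.symm, h5.symm,
        h6.symm]

lemma splitT2_isIndContained_of_star (hab : PairTrace G k a b) (hac : PairTrace G k a c)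
    (had : PairTrace G k a d) : splitT2.IsIndContained G := by
  obtain ⟨⟨x, hx, hx'⟩, ⟨y, hy, hy'⟩, ⟨z, hz, hz'⟩⟩ := And.intro hab (And.intro hac had)
  refine splitT2_isIndContained _ (adj_of_nodup hk hn) ![x, y, z] ?_ ?_
  · intro i j; fin_cases i <;> fin_cases j <;> exact hind _ _ ‹_› ‹_›
  · obtain ⟨h1, h2, h3, h4, h5, h6⟩ := nodup_four_iff.1 hn
    intro i j; fin_cases i <;> fin_cases j <;>
      simp [hx', hy', hz', h1, h2, h3, h4, h5, h6, h1.symm, h2.symm, h3.symm, h4.symm, h5.symm,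
        h6.symm]

lemma splitT3_isIndContained_of_coTrace (hb : CoTrace G k b) (hc : CoTrace G k c)
    (hd : CoTrace G k d) : splitT3.IsIndContained G := by
  obtain ⟨⟨x, hx, hx'⟩, ⟨y, hy, hy'⟩, ⟨z, hz, hz'⟩⟩ := And.intro hb (And.intro hc hd)
  refine splitT3_isIndContained _ (adj_of_nodup hk hn) ![z, y, x] ?_ ?_
  · intro i j; fin_cases i <;> fin_cases j <;> exact hind _ _ ‹_› ‹_›
  · obtain ⟨h1, h2, h3, h4, h5, h6⟩ := nodup_four_iff.1 hn
    intro i j; fin_cases i <;> fin_cases j <;>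
      simp [hx', hy', hz', h1, h2, h3, h4, h5, h6, h4.symm, h5.symm,
        h6.symm]

lemma splitT4_isIndContained_of_ends (hab : PairTrace G k a b) (had : PairTrace G k a d)
    (hb : CoTrace G k b) (hd : CoTrace G k d) : splitT4.IsIndContained G := by
  obtain ⟨⟨x, hx, hx'⟩, ⟨y, hy, hy'⟩, ⟨z, hz, hz'⟩, ⟨t, ht, ht'⟩⟩ :=
    And.intro hab (And.intro had (And.intro hb hd))
  refine splitT4_isIndContained _ (adj_of_nodup hk hn) ![x, y, t, z] ?_ ?_
  · intro i j; fin_cases i <;> fin_cases j <;> exact hind _ _ ‹_› ‹_›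
  · obtain ⟨h1, h2, h3, h4, h5, h6⟩ := nodup_four_iff.1 hn
    intro i j; fin_cases i <;> fin_cases j <;>
      simp [hx', hy', hz', ht', h1, h3, h5, h6, h1.symm, h2.symm, h3.symm, h4.symm,
        h5.symm]

/-- In this occurrence of `splitT1` the clique is not the given one: the vertex which misses only
`k c` takes the place of `k c`, and then the vertex which misses only `k a` is left with the
neighbours `k b` and `k d`. -/
lemma splitT1_isIndContained_of_centre (hab : PairTrace G k a b) (had : PairTrace G k a d)
    (ha : CoTrace G k a) (hc : CoTrace G k c) : splitT1.IsIndContained G := by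
  obtain ⟨⟨x, hx, hx'⟩, ⟨y, hy, hy'⟩, ⟨z, hz, hz'⟩, ⟨t, ht, ht'⟩⟩ :=
    And.intro hab (And.intro had (And.intro ha hc))
  obtain ⟨h1, h2, h3, h4, h5, h6⟩ := nodup_four_iff.1 hn
  refine splitT1_isIndContained ![k a, k b, k d, t]
    (adj_vecCons_four (hk _ _ h1) (hk _ _ h3) ((ht' _).2 h2).symm (hk _ _ h5) ((ht' _).2 h4).symm
      ((ht' _).2 h6.symm).symm) ![x, y, z] ?_ ?_
  · intro i j; fin_cases i <;> fin_cases j <;> exact hind _ _ ‹_› ‹_›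
  · have hxt := hind x t hx ht
    have hyt := hind y t hy ht
    have hzt := hind z t hz ht
    intro i j; fin_cases i <;> fin_cases j <;>
      simp [hx', hy', hz', hxt, hyt, hzt, h1, h3, h5, h1.symm, h3.symm,
        h5.symm]

/-- With the clique in the order `k a, k b, k c, k d`, the hypotheses rule out the opposite pairs and
the triples missing one of the two middle vertices. -/
lemma wordRepresentable_of_traces [Finite V] (hmax : ∀ v, v ∉ Set.range k → ¬ ∀ i, G.Adj v (k i))
    (hac : ¬ PairTrace G k a c) (hbd : ¬ PairTrace G k b d) (hb : ¬ CoTrace G k b)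
    (hc : ¬ CoTrace G k c) : WordRepresentable G := by
  have hall : ∀ l, l = a ∨ l = b ∨ l = c ∨ l = d := by
    clear hac hbd hb hc
    revert a b c d; decide +kernel
  have hforall : ∀ {q : Fin 4 → Prop}, q a → q b → q c → q d → ∀ l, q l := by
    intro q qa qb qc qd l
    rcases hall l with rfl | rfl | rfl | rfl <;> assumption
  have hrange : Set.range ![k a, k b, k c, k d] = Set.range k := by
    ext v
    constructor
    · rintro ⟨i, rfl⟩
      fin_cases i <;> simp
    · rintro ⟨i, rfl⟩
      revert i
      exact hforall ⟨0, rfl⟩ ⟨1, rfl⟩ ⟨2, rfl⟩ ⟨3, rfl⟩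
  obtain ⟨h1, h2, h3, h4, h5, h6⟩ := nodup_four_iff.1 hn
  refine wordRepresentable_of_arrangement _ (adj_of_nodup hk hn) ?_ ?_ ?_ ?_ ?_ ?_ <;>
    rw [hrange]
  · exact hind
  · exact fun v hv h => hmax v hv (hforall (h 0) (h 1) (h 2) (h 3))
  · rintro v hv ⟨va, vb, vc, vd⟩
    exact hac ⟨v, hv, hforall (iff_of_true va (.inl rfl)) (iff_of_false vb (by simp [h1.symm, h4]))
      (iff_of_true vc (.inr rfl)) (iff_of_false vd (by simp [h3.symm, h6.symm]))⟩
  · rintro v hv ⟨va, vb, vc, vd⟩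
    exact hbd ⟨v, hv, hforall (iff_of_false va (by simp [h1, h3])) (iff_of_true vb (.inl rfl))
      (iff_of_false vc (by simp [h4.symm, h6])) (iff_of_true vd (.inr rfl))⟩
  · rintro v hv ⟨va, vb, vc, vd⟩
    exact hc ⟨v, hv, hforall (iff_of_true va h2) (iff_of_true vb h4)
      (iff_of_false vc (by simp)) (iff_of_true vd h6.symm)⟩
  · rintro v hv ⟨va, vb, vc, vd⟩
    exact hb ⟨v, hv, hforall (iff_of_true va h1) (iff_of_false vb (by simp))
      (iff_of_true vc h4.symm) (iff_of_true vd h5.symm)⟩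

end Traces

/-! ### The characterization -/

theorem theorem7 {V : Type*} [Finite V] (G : SimpleGraph V) (E K : Set V)
    (hG : IsSplitPartition G E K) (hK : K.ncard = 4) :
    WordRepresentable G ↔
      ¬ splitT1.IsIndContained G ∧ ¬ splitT2.IsIndContained G ∧
      ¬ splitT3.IsIndContained G ∧ ¬ splitT4.IsIndContained G := by
  refine ⟨fun h => ⟨fun h1 => not_wordRepresentable_of_splitT1 h1 h,
    fun h2 => not_wordRepresentable_of_splitT2 h2 h,
    fun h3 => not_wordRepresentable_of_splitT3 h3 h,
    fun h4 => not_wordRepresentable_of_splitT4 h4 h⟩, fun ⟨h1, h2, h3, h4⟩ => ?_⟩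
  obtain ⟨hcompl, hE, hmaxK⟩ := hG
  have hEK : ∀ v, v ∉ K ↔ v ∈ E := fun v => by rw [← hcompl.symm.compl_eq]; rfl
  let e : K ≃ Fin 4 := Finite.equivFinOfCardEq hK
  let k : Fin 4 → V := fun i => e.symm i
  have hkK : ∀ i, k i ∈ K := fun i => (e.symm i).2
  have hrange : Set.range k = K := by
    ext v
    exact ⟨fun ⟨i, hi⟩ => hi ▸ hkK i, fun hv => ⟨e ⟨v, hv⟩, by simp [k]⟩⟩
  have hinj : Function.Injective k := Subtype.val_injective.comp e.symm.injective
  have hkk : ∀ i j, i ≠ j → G.Adj (k i) (k j) :=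
    fun i j hij => hmaxK.prop (hkK i) (hkK j) (hinj.ne hij)
  have hind : ∀ u v, u ∉ Set.range k → v ∉ Set.range k → ¬ G.Adj u v := by
    rw [hrange]
    exact fun u v hu hv h => hE ((hEK u).1 hu) ((hEK v).1 hv) h.ne h
  have hmax : ∀ v, v ∉ Set.range k → ¬ ∀ i, G.Adj v (k i) := by
    rw [hrange]
    intro v hv h
    refine hv (hmaxK.le_of_ge (y := insert v K) ?_ (Set.subset_insert _ _) (Set.mem_insert _ _))
    refine hmaxK.prop.insert fun u hu _ => ?_
    obtain ⟨i, rfl⟩ := hrange.symm ▸ hu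
    exact h i
  obtain ⟨a, b, c, d, hn, hac, hbd, hb, hc⟩ := exists_arrangement (PairTrace G k) (CoTrace G k)
    (fun _ _ => PairTrace.symm)
    (fun _ _ _ _ hn ⟨p, q, r⟩ => h1 (splitT1_isIndContained_of_triangle hkk hind hn p q r))
    (fun _ _ _ _ hn ⟨p, q, r⟩ => h2 (splitT2_isIndContained_of_star hkk hind hn p q r))
    (fun _ _ _ _ hn ⟨p, q, r⟩ => h3 (splitT3_isIndContained_of_coTrace hkk hind hn p q r))
    (fun _ _ _ _ hn ⟨p, q, r, s⟩ => h4 (splitT4_isIndContained_of_ends hkk hind hn p q r s))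
    (fun _ _ _ _ hn ⟨p, q, r, s⟩ => h1 (splitT1_isIndContained_of_centre hkk hind hn p q r s))
  exact wordRepresentable_of_traces hkk hind hn hmax hac hbd hb hc
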